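/- Fix a set of constants $c$. Suspension terms $t$ and environments $e$ (jointly, expressions) are given by $$t ::= c \mid \#i \mid (t\ t) \mid (\lambda\, t) \mid [\![t,n,n,e]\!],\qquad e ::= \mathit{nil} \mid (t,n)::e \mid \{\!\{e,n,n,e\}\!\},$$ with $n\in\mathbb N$ and $i$ a positive integer. Write $a \dot- b=\max(a-b,0)$. Put $len(nil)=0$, $len((t,l)::e)=1+len(e)$, $len(\{\!\{e_1,nl_1,ol_2,e_2\}\!\})=len(e_1)+(len(e_2)\dot- nl_1)$; $lev(nil)=0$, $lev((t,l)::e)=l$, $lev(\{\!\{e_1,nl_1,ol_2,e_2\}\!\})=lev(e_2)+(nl_1\dot- ol_2)$. An expression is well-formed if each subexpression $[\![t,ol,nl,e]\!]$ has $len(e)=ol$ and $lev(e)\le nl$, each $(t,l)::e$ has $lev(e)\le l$, and each $\{\!\{e_1,nl_1,ol_2,e_2\}\!\}$ has $lev(e_1)\le nl_1$ and $len(e_2)=ol_2$. Consider the rules: - ($\beta_s$) $((\lambda\,t_1)\ t_2)\to[\![t_1,1,0,(t_2,0)::nil]\!]$ - (r1) $[\![c,ol,nl,e]\!]\to c$ for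 a constant $c$ - (r2) $[\![\#i,0,nl,nil]\!]\to\#(i+nl)$ - (r3) $[\![\#1,ol,nl,(t,l)::e]\!]\to[\![t,0,nl-l,nil]\!]$ - (r4) $[\![\#i,ol,nl,(t,l)::e]\!]\to[\![\#(i-1),ol-1,nl,e]\!]$ if $i>1$ - (r5) $[\![(t_1\ t_2),ol,nl,e]\!]\to([\![t_1,ol,nl,e]\!]\ [\![t_2,ol,nl,e]\!])$ - (r6) $[\![(\lambda\,t),ol,nl,e]\!]\to(\lambda\,[\![t,ol+1,nl+1,(\#1,nl+1)::e]\!])$ - (m1) $[\![[\![t,ol_1,nl_1,e_1]\!],ol_2,nl_2,e_2]\!]\to[\![t,ol_1+(ol_2\dot- nl_1),nl_2+(nl_1\dot- ol_2),\{\!\{e_1,nl_1,ol_2,e_2\}\!\}]\!]$ - (m2) $\{\!\{e_1,nl_1,0,nil\}\!\}\to e_1$ - (m3) $\{\!\{nil,0,ol_2,e_2\}\!\}\to e_2$ - (m4) $\{\!\{nil,nl_1,ol_2,(t,l)::e_2\}\!\}\to\{\!\{nil,nl_1-1,ol_2-1,e_2\}\!\}$ if $nl_1\ge1$ - (m5)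 $\{\!\{(t,n)::e_1,nl_1,ol_2,(s,l)::e_2\}\!\}\to\{\!\{(t,n)::e_1,nl_1-1,ol_2-1,e_2\}\!\}$ if $nl_1>n$ - (m6) $\{\!\{(t,n)::e_1,n,ol_2,(s,l)::e_2\}\!\}\to([\![t,ol_2,l,(s,l)::e_2]\!],\,l+(n\dot- ol_2))::\{\!\{e_1,n,ol_2,(s,l)::e_2\}\!\}$ Write $x\rhd_{\beta_s}y$ if $y$ results from $x$ by applying ($\beta_s$) at one subexpression of $x$, and $x\rhd_{rm}y$ if $y$ results by applying one of (r1)–(r6), (m1)–(m6) at one subexpression. An rm-normal form of $x$ is a $y$ with $x\rhd_{rm}^*y$ and no $z$ with $y\rhd_{rm}z$; if it exists and is unique it is denoted $|x|$. De Bruijn terms are the suspension terms containing no suspensions $[\![\cdot]\!]$. For de Bruijn terms define $S(c;s_1,s_2,\ldots)=c$, $S(\#i;s_1,s_2,\ldots)=s_i$, $S((t_1\ t_2);s_1,\ldots)=(S(t_1;s_1,\ldots)\ S(t_2;s_1,\ldots))$, and $S((\lambda\,t);s_1,s_2,\ldots)=(\lambda\,S(t;\#1,s_1',s_2',\ldots))$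 with $s_i'=S(s_i;\#2,\#3,\ldots)$. Let $\rhd_\beta$ be the application at one subterm of the rule $((\lambda\,t_1)\ t_2)\to S(t_1;t_2,\#1,\#2,\ldots)$, and $\rhd_\beta^*$ its reflexive and transitive closure. **Theorem.** Let $t$ and $s$ be suspension terms, with $t$ well-formed, such that $t\rhd_{\beta_s}s$. Then $t$ and $s$ each have exactly one rm-normal form, these normal forms $|t|$ and $|s|$ are de Bruijn terms, and $|t|\rhd_\beta^*|s|$. -/

import Mathlib

/-- The two syntactic categories of suspension expressions: terms and environments. -/
inductive Kind where
  | tm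
  | env

/-- Suspension expressions (pre-syntax) over a set `C` of constants.  Indices are counted from `0`:
`idx i` is the de Bruijn index `#(i+1)`. -/
inductive Susp (C : Type*) : Kind → Type _ where
  | const (c : C) : Susp C .tm
  | idx (i : ℕ) : Susp C .tm
  | app (t₁ t₂ : Susp C .tm) : Susp C .tm
  | lam (t : Susp C .tm) : Susp C .tm
  /-- `⟦t, ol, nl, e⟧` -/
  | susp (t : Susp C .tm) (ol nl : ℕ) (e : Susp C .env) : Susp C .tm
  | nil : Susp C .env
  /-- `(t, l) :: e` -/
  | cons (t : Susp C .tm) (l : ℕ) (e : Susp C .env) : Susp C .env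
  /-- `{{e₁, nl₁, ol₂, e₂}}` -/
  | merge (e₁ : Susp C .env) (nl₁ ol₂ : ℕ) (e₂ : Susp C .env) : Susp C .env

namespace Susp

/-- The length of an environment (the subtraction is truncated). -/
def len {C : Type*} : Susp C .env → ℕ
  | nil => 0
  | cons _ _ e => 1 + len e
  | merge e₁ nl₁ _ e₂ => len e₁ + (len e₂ - nl₁)

/-- The level of an environment (the subtraction is truncated). -/
def lev {C : Type*} : Susp C .env → ℕ
  | nil => 0
  | cons _ l _ => l
  | merge _ nl₁ ol₂ e₂ => lev e₂ + (nl₁ - ol₂)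

/-- Well-formedness: the side conditions hold at every subexpression. -/
def WellFormed {C : Type*} : {k : Kind} → Susp C k → Prop
  | _, const _ => True
  | _, idx _ => True
  | _, app t₁ t₂ => WellFormed t₁ ∧ WellFormed t₂
  | _, lam t => WellFormed t
  | _, susp t ol nl e => WellFormed t ∧ WellFormed e ∧ len e = ol ∧ lev e ≤ nl
  | _, nil => True
  | _, cons t l e => WellFormed t ∧ WellFormed e ∧ lev e ≤ l
  | _, merge e₁ nl₁ ol₂ e₂ => WellFormed e₁ ∧ WellFormed e₂ ∧ lev e₁ ≤ nl₁ ∧ len e₂ = ol₂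

/-- Instances of the rule (β_s). -/
inductive BetaSRule {C : Type*} : {k : Kind} → Susp C k → Susp C k → Prop
  | betaS (t₁ t₂ : Susp C .tm) :
      BetaSRule (app (lam t₁) t₂) (susp t₁ 1 0 (cons t₂ 0 nil))

/-- Instances of the reading rules. -/
inductive ReadRule {C : Type*} : {k : Kind} → Susp C k → Susp C k → Prop
  | r1 (c : C) (ol nl : ℕ) (e : Susp C .env) :
      ReadRule (susp (const c) ol nl e) (const c)
  | r2 (i nl : ℕ) :
      ReadRule (susp (idx i) 0 nl nil) (idx (i + nl))
  | r3 (ol nl l : ℕ) (t : Susp C .tm) (e : Susp C .env) :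
      ReadRule (susp (idx 0) ol nl (cons t l e)) (susp t 0 (nl - l) nil)
  | r4 (i ol nl l : ℕ) (t : Susp C .tm) (e : Susp C .env) :
      ReadRule (susp (idx (i + 1)) ol nl (cons t l e)) (susp (idx i) (ol - 1) nl e)
  | r5 (t₁ t₂ : Susp C .tm) (ol nl : ℕ) (e : Susp C .env) :
      ReadRule (susp (app t₁ t₂) ol nl e) (app (susp t₁ ol nl e) (susp t₂ ol nl e))
  | r6 (t : Susp C .tm) (ol nl : ℕ) (e : Susp C .env) :
      ReadRule (susp (lam t) ol nl e)
        (lam (susp t (ol + 1) (nl + 1) (cons (idx 0) (nl + 1) e)))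

/-- Instances of the merging rules. -/
inductive MergeRule {C : Type*} : {k : Kind} → Susp C k → Susp C k → Prop
  | m1 (t : Susp C .tm) (ol₁ nl₁ ol₂ nl₂ : ℕ) (e₁ e₂ : Susp C .env) :
      MergeRule (susp (susp t ol₁ nl₁ e₁) ol₂ nl₂ e₂)
        (susp t (ol₁ + (ol₂ - nl₁)) (nl₂ + (nl₁ - ol₂)) (merge e₁ nl₁ ol₂ e₂))
  | m2 (e₁ : Susp C .env) (nl₁ : ℕ) :
      MergeRule (merge e₁ nl₁ 0 nil) e₁
  | m3 (ol₂ : ℕ) (e₂ : Susp C .env) :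
      MergeRule (merge nil 0 ol₂ e₂) e₂
  | m4 (nl₁ ol₂ l : ℕ) (t : Susp C .tm) (e₂ : Susp C .env) (h : 1 ≤ nl₁) :
      MergeRule (merge nil nl₁ ol₂ (cons t l e₂)) (merge nil (nl₁ - 1) (ol₂ - 1) e₂)
  | m5 (n nl₁ ol₂ l : ℕ) (t s : Susp C .tm) (e₁ e₂ : Susp C .env) (h : n < nl₁) :
      MergeRule (merge (cons t n e₁) nl₁ ol₂ (cons s l e₂))
        (merge (cons t n e₁) (nl₁ - 1) (ol₂ - 1) e₂)
  | m6 (n ol₂ l : ℕ) (t s : Susp C .tm) (e₁ e₂ : Susp C .env) :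
      MergeRule (merge (cons t n e₁) n ol₂ (cons s l e₂))
        (cons (susp t ol₂ l (cons s l e₂)) (l + (n - ol₂))
          (merge e₁ n ol₂ (cons s l e₂)))

/-- `AtSub R x y`: `y` results from `x` by applying `R` at exactly one subexpression of `x`. -/
inductive AtSub {C : Type*} (R : (k : Kind) → Susp C k → Susp C k → Prop) :
    {k : Kind} → Susp C k → Susp C k → Prop
  | root {k : Kind} {x y : Susp C k} (h : R k x y) : AtSub R x y
  | appL {t₁ t₁' : Susp C .tm} (t₂ : Susp C .tm) (h : AtSub R t₁ t₁') :
      AtSub R (app t₁ t₂) (app t₁' t₂)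
  | appR (t₁ : Susp C .tm) {t₂ t₂' : Susp C .tm} (h : AtSub R t₂ t₂') :
      AtSub R (app t₁ t₂) (app t₁ t₂')
  | lam {t t' : Susp C .tm} (h : AtSub R t t') :
      AtSub R (lam t) (lam t')
  | suspL {t t' : Susp C .tm} (ol nl : ℕ) (e : Susp C .env) (h : AtSub R t t') :
      AtSub R (susp t ol nl e) (susp t' ol nl e)
  | suspR (t : Susp C .tm) (ol nl : ℕ) {e e' : Susp C .env} (h : AtSub R e e') :
      AtSub R (susp t ol nl e) (susp t ol nl e')
  | consL {t t' : Susp C .tm} (l : ℕ) (e : Susp C .env) (h : AtSub R t t') :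
      AtSub R (cons t l e) (cons t' l e)
  | consR (t : Susp C .tm) (l : ℕ) {e e' : Susp C .env} (h : AtSub R e e') :
      AtSub R (cons t l e) (cons t l e')
  | mergeL {e₁ e₁' : Susp C .env} (nl₁ ol₂ : ℕ) (e₂ : Susp C .env) (h : AtSub R e₁ e₁') :
      AtSub R (merge e₁ nl₁ ol₂ e₂) (merge e₁' nl₁ ol₂ e₂)
  | mergeR (e₁ : Susp C .env) (nl₁ ol₂ : ℕ) {e₂ e₂' : Susp C .env} (h : AtSub R e₂ e₂') :
      AtSub R (merge e₁ nl₁ ol₂ e₂) (merge e₁ nl₁ ol₂ e₂')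

/-- A `β_s`-contraction step. -/
def BetaS {C : Type*} {k : Kind} (x y : Susp C k) : Prop := AtSub (@BetaSRule C) x y

/-- A reading step. -/
def ReadStep {C : Type*} {k : Kind} (x y : Susp C k) : Prop := AtSub (@ReadRule C) x y

/-- A merging step. -/
def MergeStep {C : Type*} {k : Kind} (x y : Susp C k) : Prop := AtSub (@MergeRule C) x y

/-- A reading or merging step. -/
def RM {C : Type*} {k : Kind} (x y : Susp C k) : Prop := ReadStep x y ∨ MergeStep x y

/-- `y` is an rm-normal form of `x`. -/
def IsRMNormalForm {C : Type*} {k : Kind} (x y : Susp C k) : Prop :=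
  Relation.ReflTransGen RM x y ∧ ∀ z, ¬ RM y z

end Susp

/-- De Bruijn terms over the constants `C`; again `idx i` is the index `#(i+1)`. -/
inductive DB (C : Type*) where
  | const (c : C)
  | idx (i : ℕ)
  | app (t₁ t₂ : DB C)
  | lam (t : DB C)

namespace DB

/-- De Bruijn terms are the suspension terms that contain no suspensions. -/
def toSusp {C : Type*} : DB C → Susp C .tm
  | const c => .const c
  | idx i => .idx i
  | app t₁ t₂ => .app (toSusp t₁) (toSusp t₂)
  | lam t => .lam (toSusp t)

/-- Prefix a sequence by an element. -/
def scons {α : Type*} (a : α) (s : ℕ → α) : ℕ → α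
  | 0 => a
  | i + 1 => s i

/-- Renaming of the free variables; used to define `subst` by structural recursion. -/
def rename {C : Type*} : DB C → (ℕ → ℕ) → DB C
  | const c, _ => const c
  | idx i, r => idx (r i)
  | app t₁ t₂, r => app (rename t₁ r) (rename t₂ r)
  | lam t, r => lam (rename t (scons 0 (fun i => r i + 1)))

/-- Simultaneous substitution `S(t; s 0, s 1, s 2, …)`.  By `subst_lam` below, the sequence used
under an abstraction is `#1, S(s 0; #2, #3, …), S(s 1; #2, #3, …), …`. -/
def subst {C : Type*} : DB C → (ℕ → DB C) → DB C
  | const c, _ => const c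
  | idx i, s => s i
  | app t₁ t₂, s => app (subst t₁ s) (subst t₂ s)
  | lam t, s => lam (subst t (scons (idx 0) (fun i => rename (s i) (fun j => j + 1))))

theorem rename_eq_subst {C : Type*} (t : DB C) (r : ℕ → ℕ) :
    rename t r = subst t (fun i => idx (r i)) := by
  induction t generalizing r with
  | const c => rfl
  | idx i => rfl
  | app t₁ t₂ h₁ h₂ => simp only [rename, subst, h₁, h₂]
  | lam t h =>
    simp only [rename, subst, h]
    congr 2
    funext i
    cases i <;> rfl

theorem subst_lam {C : Type*} (t : DB C) (s : ℕ → DB C) :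
    subst (lam t) s =
      lam (subst t (scons (idx 0) (fun i => subst (s i) (fun j => idx (j + 1))))) := by
  simp only [subst, rename_eq_subst]

/-- One-step β-contraction of de Bruijn terms, at any subterm. -/
inductive Beta {C : Type*} : DB C → DB C → Prop
  | beta (t₁ t₂ : DB C) : Beta (app (lam t₁) t₂) (subst t₁ (scons t₂ idx))
  | appL {t₁ t₁' : DB C} (t₂ : DB C) (h : Beta t₁ t₁') : Beta (app t₁ t₂) (app t₁' t₂)
  | appR (t₁ : DB C) {t₂ t₂' : DB C} (h : Beta t₂ t₂') : Beta (app t₁ t₂) (app t₁ t₂')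
  | lam {t t' : DB C} (h : Beta t t') : Beta (lam t) (lam t')

end DB

/-! Neither confluence nor strong normalisation of rm is needed, because suspension expressions have
a denotation `den`: a term denotes the de Bruijn term obtained by carrying out all its suspended
substitutions, an environment a substitution for each embedding level. On well-formed expressions,
rm steps preserve denotations (`RM.denRel`) and a β_s step turns into a β-reduction sequence
(`AtSub.denRel`, `BetaSRule.denRel`). Every well-formed term has some rm-reduct that is a de Bruijn
term (`exists_evaluated`). A de Bruijn term is rm-normal and denotes itself, so that reduct must be
`(den t).toSusp`, and it is the only normal form. The theorem then compares `den t` with `den s`. -/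

namespace DB

variable {C : Type*}

/-! ### Substitution calculus for de Bruijn terms -/

theorem rename_rename (t : DB C) (r r' : ℕ → ℕ) :
    rename (rename t r) r' = rename t (fun i => r' (r i)) := by
  induction t generalizing r r' with
  | const c => rfl
  | idx i => rfl
  | app t₁ t₂ h₁ h₂ => simp only [rename, h₁, h₂]
  | lam t h =>
    simp only [rename, h]
    congr 2
    funext i
    cases i <;> rfl

theorem subst_rename (t : DB C) (r : ℕ → ℕ) (σ : ℕ → DB C) :
    subst (rename t r) σ = subst t (fun i => σ (r i)) := by
  induction t generalizing r σ with
  | const c => rfl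
  | idx i => rfl
  | app t₁ t₂ h₁ h₂ => simp only [rename, subst, h₁, h₂]
  | lam t h =>
    simp only [rename, subst, h]
    congr 2
    funext i
    cases i <;> rfl

theorem rename_subst (t : DB C) (σ : ℕ → DB C) (r : ℕ → ℕ) :
    rename (subst t σ) r = subst t (fun i => rename (σ i) r) := by
  induction t generalizing r σ with
  | const c => rfl
  | idx i => rfl
  | app t₁ t₂ h₁ h₂ => simp only [rename, subst, h₁, h₂]
  | lam t h =>
    simp only [rename, subst, h]
    congr 2
    funext i
    cases i
    · rfl
    · simp only [scons, rename_rename]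

theorem subst_subst (t : DB C) (σ τ : ℕ → DB C) :
    subst (subst t σ) τ = subst t (fun i => subst (σ i) τ) := by
  induction t generalizing σ τ with
  | const c => rfl
  | idx i => rfl
  | app t₁ t₂ h₁ h₂ => simp only [subst, h₁, h₂]
  | lam t h =>
    simp only [subst, h]
    congr 2
    funext i
    cases i
    · rfl
    · simp only [scons, subst_rename, rename_subst]

theorem subst_idx (t : DB C) : subst t idx = t := by
  induction t with
  | const c => rfl
  | idx i => rfl
  | app t₁ t₂ h₁ h₂ => simp only [subst, h₁, h₂]
  | lam t h =>
    have : (scons (idx 0) fun i => rename (idx i : DB C) fun j => j + 1) = idx := by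
      funext i
      cases i <;> rfl
    simp only [subst, this, h]

theorem rename_id (t : DB C) : rename t (fun i => i) = t := by
  rw [rename_eq_subst]
  exact subst_idx t

/-! ### β-reduction and substitution -/

theorem Beta.subst {t t' : DB C} (h : Beta t t') (σ : ℕ → DB C) :
    Beta (t.subst σ) (t'.subst σ) := by
  induction h generalizing σ with
  | beta t₁ t₂ =>
    have e : (t₁.subst (scons t₂ idx)).subst σ =
        (t₁.subst (scons (idx 0) fun i => rename (σ i) fun j => j + 1)).subst
          (scons (t₂.subst σ) idx) := by
      rw [subst_subst, subst_subst]
      congr 1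
      funext i
      cases i
      · rfl
      · simp only [scons, subst_rename]
        exact (subst_idx _).symm
    rw [e]
    exact .beta _ _
  | appL t₂ _ ih => exact .appL _ (ih σ)
  | appR t₁ _ ih => exact .appR _ (ih σ)
  | lam _ ih => exact .lam (ih _)

/-- A reflexive relation on de Bruijn terms that is compatible with the term constructors
and with substitution in both arguments. -/
structure Compatible (r : DB C → DB C → Prop) : Prop where
  refl (t : DB C) : r t t
  app {t₁ t₁' t₂ t₂' : DB C} : r t₁ t₁' → r t₂ t₂' → r (app t₁ t₂) (app t₁' t₂')
  lam {t t' : DB C} : r t t' → r (lam t) (lam t')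
  subst_left {t t' : DB C} (σ : ℕ → DB C) : r t t' → r (t.subst σ) (t'.subst σ)
  subst_right (t : DB C) {σ σ' : ℕ → DB C} : (∀ i, r (σ i) (σ' i)) → r (t.subst σ) (t.subst σ')

theorem Compatible.rename {r : DB C → DB C → Prop} (hr : Compatible r) {t t' : DB C}
    (h : r t t') (f : ℕ → ℕ) : r (t.rename f) (t'.rename f) := by
  simpa only [rename_eq_subst] using hr.subst_left _ h

theorem compatible_eq : Compatible (@Eq (DB C)) where
  refl _ := rfl
  app h₁ h₂ := h₁ ▸ h₂ ▸ rfl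
  lam h := h ▸ rfl
  subst_left _ h := h ▸ rfl
  subst_right _ _ _ h := congrArg _ (funext h)

theorem reflTransGen_beta_app {t₁ t₁' t₂ t₂' : DB C} (h₁ : Relation.ReflTransGen Beta t₁ t₁')
    (h₂ : Relation.ReflTransGen Beta t₂ t₂') :
    Relation.ReflTransGen Beta (app t₁ t₂) (app t₁' t₂') :=
  (h₁.lift (app · t₂) fun _ _ h => .appL _ h).trans (h₂.lift (app t₁' ·) fun _ _ h => .appR _ h)

/-- A variable may occur any number of times in `t`, so even single steps in `σ` force the reflexive
transitive closure here. -/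
theorem reflTransGen_beta_subst_right (t : DB C) {σ σ' : ℕ → DB C}
    (h : ∀ i, Relation.ReflTransGen Beta (σ i) (σ' i)) :
    Relation.ReflTransGen Beta (t.subst σ) (t.subst σ') := by
  induction t generalizing σ σ' with
  | const c => exact .refl
  | idx i => exact h i
  | app t₁ t₂ h₁ h₂ => exact reflTransGen_beta_app (h₁ h) (h₂ h)
  | lam t ih =>
    refine (ih fun i => ?_).lift lam fun _ _ h => .lam h
    cases i with
    | zero => exact .refl
    | succ i =>
      refine (h i).lift (fun t => rename t fun j => j + 1) fun a b hab => ?_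
      simpa only [rename_eq_subst] using hab.subst _

theorem compatible_reflTransGen_beta : Compatible (Relation.ReflTransGen (@Beta C)) where
  refl _ := .refl
  app := reflTransGen_beta_app
  lam h := h.lift lam fun _ _ h => .lam h
  subst_left σ h := h.lift (subst · σ) fun _ _ h => h.subst σ
  subst_right := reflTransGen_beta_subst_right

end DB

/-! ### Denotations of suspension expressions -/

namespace Susp

variable {C : Type*}

open Relation

/-- Denotations: a term denotes a de Bruijn term, and an environment denotes a substitution
for each new embedding level. -/
abbrev Den (C : Type*) : Kind → Type _
  | .tm => DB C
  | .env => ℕ → ℕ → DB C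

/-- The denotation of a suspension expression. -/
def den : {k : Kind} → Susp C k → Den C k
  | _, const c => DB.const c
  | _, idx i => DB.idx i
  | _, app t₁ t₂ => DB.app (den t₁) (den t₂)
  | _, lam t => DB.lam (den t)
  | _, susp t _ nl e => DB.subst (den t) (den e nl)
  | _, nil => fun nl i => DB.idx (i + nl)
  -- The entry `t` was recorded at level `l`, so reading it at level `nl` shifts it by the
  -- difference.
  | _, cons t l e => fun nl =>
      DB.scons (DB.rename (den t) fun j => j + (nl - l)) (den e nl)
  -- Composition of substitutions. Rule (m1) raises the outer level by `nl₁ - ol₂`, and this is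
  -- undone before reading `e₂`.
  | _, merge e₁ nl₁ ol₂ e₂ => fun nl i =>
      DB.subst (den e₁ nl₁ i) (den e₂ (nl - (nl₁ - ol₂)))

theorem lev_nil : lev (nil : Susp C .env) = 0 := by simp only [lev]

theorem lev_cons (t : Susp C .tm) (l : ℕ) (e : Susp C .env) : lev (cons t l e) = l := by
  simp only [lev]

theorem len_nil : len (nil : Susp C .env) = 0 := by simp only [len]

theorem den_toSusp (d : DB C) : den d.toSusp = d := by
  induction d with
  | const c => rfl
  | idx i => rfl
  | app t₁ t₂ h₁ h₂ => simp only [DB.toSusp, den, h₁, h₂]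
  | lam t h => simp only [DB.toSusp, den, h]

/-- Raising the new embedding level of an environment shifts the substitution it denotes. -/
theorem den_add : ∀ (e : Susp C .env), e.WellFormed → ∀ {nl : ℕ}, e.lev ≤ nl → ∀ m i : ℕ,
    den e (nl + m) i = DB.rename (den e nl i) (fun j => j + m)
  | nil, _, nl, _, m, i => by simp only [den, DB.rename, Nat.add_assoc]
  | cons t l e, he, nl, hl, m, 0 => by
    simp only [lev] at hl
    simp only [den, DB.scons, DB.rename_rename]
    congr 1
    funext j
    omega
  | cons t l e, he, nl, hl, m, i + 1 => by
    simp only [lev] at hl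
    exact den_add e he.2.1 (he.2.2.trans hl) m i
  | merge e₁ nl₁ ol₂ e₂, he, nl, hl, m, i => by
    simp only [lev] at hl
    simp only [den, DB.rename_subst]
    congr 1
    funext j
    rw [← den_add e₂ he.2.1 (nl := nl - (nl₁ - ol₂)) (by omega)]
    rw [Nat.sub_add_comm (by omega)]

/-! ### Soundness of the rewrite rules -/

/-- `DenRel r x y`: the denotations of `x` and `y` are related by `r`, and `y` can replace `x` in
a well-formed expression. -/
def DenRel (r : DB C → DB C → Prop) : {k : Kind} → Susp C k → Susp C k → Prop
  | .tm, x, y => r (den x) (den y)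
  -- The level may drop, as in (m2), hence `≤`; truncated subtraction makes levels below `lev x`
  -- meaningless.
  | .env, x, y => len y = len x ∧ lev y ≤ lev x ∧ ∀ nl, lev x ≤ nl → ∀ i, r (den x nl i) (den y nl i)

/-- One congruence argument serves both equality (for rm) and β-reduction (for β_s). Closure under
substitution in both arguments handles steps in the body or the environment of a suspension. -/
theorem AtSub.denRel {r : DB C → DB C → Prop} (hr : DB.Compatible r)
    {R : (k : Kind) → Susp C k → Susp C k → Prop}
    (hR : ∀ {k : Kind} {x y : Susp C k}, R k x y → x.WellFormed → y.WellFormed ∧ DenRel r x y)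
    {k : Kind} {x y : Susp C k} (h : AtSub R x y) (hx : x.WellFormed) :
    y.WellFormed ∧ DenRel r x y := by
  induction h with
  | root h => exact hR h hx
  | appL t₂ _ ih =>
    obtain ⟨hw, hd⟩ := ih hx.1
    exact ⟨⟨hw, hx.2⟩, hr.app hd (hr.refl _)⟩
  | appR t₁ _ ih =>
    obtain ⟨hw, hd⟩ := ih hx.2
    exact ⟨⟨hx.1, hw⟩, hr.app (hr.refl _) hd⟩
  | lam _ ih =>
    obtain ⟨hw, hd⟩ := ih hx
    exact ⟨hw, hr.lam hd⟩
  | suspL ol nl e _ ih =>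
    obtain ⟨hw, hd⟩ := ih hx.1
    exact ⟨⟨hw, hx.2⟩, hr.subst_left _ hd⟩
  | suspR t ol nl _ ih =>
    obtain ⟨hw, hlen, hlev, hd⟩ := ih hx.2.1
    exact ⟨⟨hx.1, hw, hlen.trans hx.2.2.1, hlev.trans hx.2.2.2⟩,
      hr.subst_right _ (hd nl hx.2.2.2)⟩
  | consL l e _ ih =>
    obtain ⟨hw, hd⟩ := ih hx.1
    refine ⟨⟨hw, hx.2⟩, by simp only [len], by simp only [lev, le_refl], fun nl _ i => ?_⟩
    cases i
    · exact hr.rename hd _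
    · exact hr.refl _
  | consR t l _ ih =>
    obtain ⟨hw, hlen, hlev, hd⟩ := ih hx.2.1
    refine ⟨⟨hx.1, hw, hlev.trans hx.2.2⟩, by simp only [len, hlen],
      by simp only [lev, le_refl], fun nl hl i => ?_⟩
    rw [lev_cons] at hl
    cases i
    · exact hr.refl _
    · exact hd nl (hx.2.2.trans hl) _
  | mergeL nl₁ ol₂ e₂ _ ih =>
    obtain ⟨hw, hlen, hlev, hd⟩ := ih hx.1
    exact ⟨⟨hw, hx.2.1, hlev.trans hx.2.2.1, hx.2.2.2⟩, by simp only [len, hlen],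
      by simp only [lev, le_refl], fun nl _ i => hr.subst_left _ (hd nl₁ hx.2.2.1 i)⟩
  | mergeR e₁ nl₁ ol₂ _ ih =>
    obtain ⟨hw, hlen, hlev, hd⟩ := ih hx.2.1
    refine ⟨⟨hx.1, hw, hx.2.2.1, hlen.trans hx.2.2.2⟩, by simp only [len, hlen],
      by simp only [lev]; omega, fun nl hl i => hr.subst_right _ (hd _ ?_)⟩
    simp only [lev] at hl
    omega

theorem BetaSRule.denRel {k : Kind} {x y : Susp C k} (h : BetaSRule x y) (hx : x.WellFormed) :
    y.WellFormed ∧ DenRel (ReflTransGen DB.Beta) x y := by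
  cases h with
  | betaS t₁ t₂ =>
    refine ⟨⟨hx.1, ⟨hx.2, trivial, lev_nil.le⟩, by simp only [len], (lev_cons _ _ _).le⟩, .single ?_⟩
    -- At level 0 nothing is shifted, so this is exactly the substitution of the β-rule.
    have e : den (cons t₂ 0 nil) 0 = DB.scons (den t₂) DB.idx := by
      funext i
      cases i
      · exact DB.rename_id _
      · rfl
    simp only [den] at e ⊢
    rw [e]
    exact .beta _ _

theorem ReadRule.denRel {k : Kind} {x y : Susp C k} (h : ReadRule x y) (hx : x.WellFormed) :
    y.WellFormed ∧ DenRel Eq x y := by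
  cases h with
  | r1 c ol nl e => exact ⟨trivial, rfl⟩
  | r2 i nl => exact ⟨trivial, rfl⟩
  | r3 ol nl l t e =>
    exact ⟨⟨hx.2.1.1, trivial, len_nil, by simp only [lev_nil, Nat.zero_le]⟩, DB.rename_eq_subst _ _⟩
  | r4 i ol nl l t e =>
    obtain ⟨-, ⟨-, he, hle⟩, hlen, hlev⟩ := hx
    simp only [len, lev] at hlen hlev
    exact ⟨⟨trivial, he, by omega, by omega⟩, rfl⟩
  | r5 t₁ t₂ ol nl e => exact ⟨⟨⟨hx.1.1, hx.2⟩, ⟨hx.1.2, hx.2⟩⟩, rfl⟩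
  | r6 t ol nl e =>
    obtain ⟨ht, he, hlen, hlev⟩ := hx
    refine ⟨⟨ht, ⟨trivial, he, by omega⟩, by simp only [len]; omega, (lev_cons _ _ _).le⟩, ?_⟩
    simp only [DenRel, den, DB.subst]
    congr 2
    funext i
    cases i
    -- The dummy `#1` has the current level `nl + 1`, so it is not shifted; the other entries are
    -- shifted by one.
    · simp [DB.scons, DB.rename]
    · exact (den_add e he hlev 1 _).symm

theorem MergeRule.denRel {k : Kind} {x y : Susp C k} (h : MergeRule x y) (hx : x.WellFormed) :
    y.WellFormed ∧ DenRel Eq x y := by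
  cases h with
  | m1 t ol₁ nl₁ ol₂ nl₂ e₁ e₂ =>
    obtain ⟨⟨ht, he₁, hlen₁, hlev₁⟩, he₂, hlen₂, hlev₂⟩ := hx
    refine ⟨⟨ht, ⟨he₁, he₂, hlev₁, hlen₂⟩, by simp only [len]; omega, by simp only [lev]; omega⟩, ?_⟩
    simp only [DenRel, den, DB.subst_subst, Nat.add_sub_cancel]
  | m2 e₁ nl₁ =>
    obtain ⟨he₁, -, hlev₁, -⟩ := hx
    refine ⟨he₁, by simp [len], by simpa [lev] using hlev₁, fun nl hl i => ?_⟩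
    simp only [lev] at hl
    -- The empty environment read at level `nl - nl₁` is a pure shift, the one that takes `e₁` from
    -- level `nl₁` to `nl`.
    obtain ⟨m, rfl⟩ := Nat.exists_eq_add_of_le (show nl₁ ≤ nl by omega)
    rw [den_add e₁ he₁ hlev₁]
    simp only [den, DB.rename_eq_subst]
    congr 1
    funext j
    congr 1
    omega
  | m3 ol₂ e₂ =>
    refine ⟨hx.2.1, by simp [len], by simp [lev], fun nl hl i => ?_⟩
    simp [den, DB.subst]
  | m4 nl₁ ol₂ l t e₂ h =>
    obtain ⟨he₁, ⟨ht, he₂, hlev₂⟩, hlev₁, hlen₂⟩ := hx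
    simp only [len] at hlen₂
    refine ⟨⟨he₁, he₂, by simp only [lev_nil, Nat.zero_le], by omega⟩, by simp only [len]; omega,
      by simp only [lev]; omega, fun nl hl i => ?_⟩
    -- Every index in the image of `nil` at a positive level skips the head of the second
    -- environment. As `ol₂` is positive too, `nl₁ - ol₂` is unchanged.
    obtain ⟨n, rfl⟩ := Nat.exists_eq_add_of_le' h
    obtain ⟨o, rfl⟩ : ∃ o, ol₂ = o + 1 := ⟨len e₂, by omega⟩
    simp only [den, DB.subst, Nat.add_sub_cancel, Nat.add_sub_add_right, ← Nat.add_assoc, DB.scons]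
  | m5 n nl₁ ol₂ l t s e₁ e₂ h =>
    obtain ⟨he₁, ⟨hs, he₂, hlev₂⟩, hlev₁, hlen₂⟩ := hx
    simp only [len] at hlen₂
    refine ⟨⟨he₁, he₂, by simp only [lev]; omega, by omega⟩, by simp only [len]; omega,
      by simp only [lev]; omega, fun nl hl i => ?_⟩
    obtain ⟨m, rfl⟩ : ∃ m, nl₁ = m + 1 := ⟨nl₁ - 1, by omega⟩
    obtain ⟨o, rfl⟩ : ∃ o, ol₂ = o + 1 := ⟨len e₂, by omega⟩
    change DB.subst (den (cons t n e₁) (m + 1) i)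
      (den (cons s l e₂) (nl - (m + 1 - (o + 1)))) = _
    -- Since `n ≤ m`, the first environment at level `m + 1` is a shift by one of its value at `m`,
    -- so it never reaches the head `s`.
    rw [den_add _ he₁ (nl := m) (by simp only [lev]; omega), DB.subst_rename]
    simp only [den, Nat.add_sub_cancel, Nat.add_sub_add_right, DB.scons]
  | m6 n ol₂ l t s e₁ e₂ =>
    obtain ⟨⟨ht, he₁, hle₁⟩, he₂, hlev₁, hlen₂⟩ := hx
    refine ⟨⟨⟨ht, he₂, hlen₂, (lev_cons _ _ _).le⟩, ⟨he₁, he₂, hle₁, hlen₂⟩, by simp only [lev, le_refl]⟩,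
      by simp only [len]; omega, by simp only [lev, le_refl], fun nl hl i => ?_⟩
    cases i with
    | succ i => rfl
    | zero =>
      simp only [lev] at hl
      obtain ⟨m, rfl⟩ := Nat.exists_eq_add_of_le hl
      have e : l + (n - ol₂) + m - (n - ol₂) = l + m := by omega
      change DB.subst (DB.rename (den t) fun j => j + (n - n))
          (den (cons s l e₂) (l + (n - ol₂) + m - (n - ol₂))) =
        DB.rename (DB.subst (den t) (den (cons s l e₂) l))
          fun j => j + (l + (n - ol₂) + m - (l + (n - ol₂)))
      rw [e, DB.subst_rename, DB.rename_subst]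
      congr 1
      funext j
      rw [den_add _ he₂ (lev_cons _ _ _).le, Nat.sub_self, Nat.add_zero, Nat.add_sub_cancel_left]

theorem RM.denRel {k : Kind} {x y : Susp C k} (h : RM x y) (hx : x.WellFormed) :
    y.WellFormed ∧ DenRel Eq x y :=
  h.elim (fun h => AtSub.denRel DB.compatible_eq ReadRule.denRel h hx)
    (fun h => AtSub.denRel DB.compatible_eq MergeRule.denRel h hx)

theorem wellFormed_of_reflTransGen {k : Kind} {x y : Susp C k} (h : ReflTransGen RM x y)
    (hx : x.WellFormed) : y.WellFormed := by
  induction h with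
  | refl => exact hx
  | tail _ h ih => exact (h.denRel ih).1

theorem den_eq_of_reflTransGen {x y : Susp C .tm} (h : ReflTransGen RM x y)
    (hx : x.WellFormed) : den x = den y := by
  induction h with
  | refl => rfl
  | tail h' h ih => exact ih.trans (h.denRel (wellFormed_of_reflTransGen h' hx)).2

theorem len_lev_of_reflTransGen {x y : Susp C .env} (h : ReflTransGen RM x y)
    (hx : x.WellFormed) : len y = len x ∧ lev y ≤ lev x := by
  induction h with
  | refl => exact ⟨rfl, le_rfl⟩
  | tail h' h ih =>
    have := (h.denRel (wellFormed_of_reflTransGen h' hx)).2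
    exact ⟨this.1.trans ih.1, this.2.1.trans ih.2⟩

/-! ### Existence of evaluated reducts -/

theorem ReadRule.rm {k : Kind} {x y : Susp C k} (h : ReadRule x y) : RM x y := .inl (.root h)

theorem MergeRule.rm {k : Kind} {x y : Susp C k} (h : MergeRule x y) : RM x y := .inr (.root h)

theorem rms_app {t₁ t₁' t₂ t₂' : Susp C .tm} (h₁ : ReflTransGen RM t₁ t₁')
    (h₂ : ReflTransGen RM t₂ t₂') : ReflTransGen RM (app t₁ t₂) (app t₁' t₂') :=
  (h₁.lift (app · t₂) fun _ _ h => h.imp (.appL _) (.appL _)).trans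
    (h₂.lift (app t₁' ·) fun _ _ h => h.imp (.appR _) (.appR _))

theorem rms_lam {t t' : Susp C .tm} (h : ReflTransGen RM t t') :
    ReflTransGen RM (lam t) (lam t') :=
  h.lift lam fun _ _ h => h.imp .lam .lam

theorem rms_susp {t t' : Susp C .tm} {e e' : Susp C .env} (ol nl : ℕ) (h₁ : ReflTransGen RM t t')
    (h₂ : ReflTransGen RM e e') : ReflTransGen RM (susp t ol nl e) (susp t' ol nl e') :=
  (h₁.lift (susp · ol nl e) fun _ _ h => h.imp (.suspL _ _ _) (.suspL _ _ _)).trans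
    (h₂.lift (susp t' ol nl ·) fun _ _ h => h.imp (.suspR _ _ _) (.suspR _ _ _))

theorem rms_cons {t t' : Susp C .tm} {e e' : Susp C .env} (l : ℕ) (h₁ : ReflTransGen RM t t')
    (h₂ : ReflTransGen RM e e') : ReflTransGen RM (cons t l e) (cons t' l e') :=
  (h₁.lift (cons · l e) fun _ _ h => h.imp (.consL _ _) (.consL _ _)).trans
    (h₂.lift (cons t' l ·) fun _ _ h => h.imp (.consR _ _) (.consR _ _))

theorem rms_merge {e₁ e₁' e₂ e₂' : Susp C .env} (nl₁ ol₂ : ℕ) (h₁ : ReflTransGen RM e₁ e₁')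
    (h₂ : ReflTransGen RM e₂ e₂') :
    ReflTransGen RM (merge e₁ nl₁ ol₂ e₂) (merge e₁' nl₁ ol₂ e₂') :=
  (h₁.lift (merge · nl₁ ol₂ e₂) fun _ _ h => h.imp (.mergeL _ _ _) (.mergeL _ _ _)).trans
    (h₂.lift (merge e₁' nl₁ ol₂ ·) fun _ _ h => h.imp (.mergeR _ _ _) (.mergeR _ _ _))

theorem RM.elim_toSusp {d : DB C} {z : Susp C .tm} (h : RM d.toSusp z) : False := by
  induction d generalizing z with
  | const c =>
    simp only [DB.toSusp] at h
    rcases h with h | h <;> cases h with | root h => cases h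
  | idx i =>
    simp only [DB.toSusp] at h
    rcases h with h | h <;> cases h with | root h => cases h
  | app t₁ t₂ h₁ h₂ =>
    simp only [DB.toSusp] at h
    rcases h with h | h
    · cases h with
      | root h => cases h
      | appL _ h => exact h₁ (.inl h)
      | appR _ h => exact h₂ (.inl h)
    · cases h with
      | root h => cases h
      | appL _ h => exact h₁ (.inr h)
      | appR _ h => exact h₂ (.inr h)
  | lam t ih =>
    simp only [DB.toSusp] at h
    rcases h with h | h
    · cases h with
      | root h => cases h
      | lam h => exact ih (.inl h)
    · cases h with
      | root h => cases h
      | lam h => exact ih (.inr h)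

/-- Environments without merges whose terms are de Bruijn terms satisfying `P`. -/
inductive Simple (P : DB C → Prop) : Susp C .env → Prop
  | nil : Simple P nil
  | cons {d : DB C} (hd : P d) (l : ℕ) {e : Susp C .env} (he : Simple P e) :
      Simple P (cons d.toSusp l e)

/-- If suspensions of the terms satisfying `P` under the empty environment normalise, then so do
suspensions of arbitrary de Bruijn terms under environments whose terms satisfy `P`. -/
theorem exists_reduct_susp {P : DB C → Prop} (hidx : P (.idx 0))
    (hP : ∀ d, P d → ∀ nl, ∃ d' : DB C, ReflTransGen RM (susp d.toSusp 0 nl nil) d'.toSusp)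
    (d : DB C) {e : Susp C .env} (hs : Simple P e) (he : e.WellFormed) {ol nl : ℕ}
    (hlen : len e = ol) (hlev : lev e ≤ nl) :
    ∃ d' : DB C, ReflTransGen RM (susp d.toSusp ol nl e) d'.toSusp := by
  induction d generalizing e ol nl with
  | const c => exact ⟨.const c, .single (ReadRule.r1 c ol nl e).rm⟩
  | idx i =>
    -- (r4) walks down the environment until (r2) or (r3) applies; only (r3) needs `hP`, as it
    -- suspends a term that is not a subterm of `d`.
    induction hs generalizing ol i with
    | nil =>
      obtain rfl : 0 = ol := len_nil.symm.trans hlen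
      exact ⟨.idx (i + nl), .single (ReadRule.r2 i nl).rm⟩
    | @cons d hd l e he' ih =>
      cases i with
      | zero =>
        obtain ⟨d', h⟩ := hP d hd (nl - l)
        exact ⟨d', .head (ReadRule.r3 ol nl l _ e).rm h⟩
      | succ i =>
        simp only [len, lev] at hlen hlev
        obtain ⟨d', h⟩ := ih (ol := ol - 1) i he.2.1 (by omega) (he.2.2.trans hlev)
        exact ⟨d', .head (ReadRule.r4 i ol nl l _ e).rm h⟩
  | app t₁ t₂ h₁ h₂ =>
    obtain ⟨d₁, h₁⟩ := h₁ hs he hlen hlev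
    obtain ⟨d₂, h₂⟩ := h₂ hs he hlen hlev
    exact ⟨.app d₁ d₂, .head (ReadRule.r5 _ _ ol nl e).rm (rms_app h₁ h₂)⟩
  | lam t ih =>
    obtain ⟨d, h⟩ := ih (e := cons (idx 0) (nl + 1) e) (ol := ol + 1) (nl := nl + 1)
      (.cons hidx _ hs) (by simp only [WellFormed]; exact ⟨trivial, he, by omega⟩)
      (by simp only [len]; omega) (lev_cons _ _ _).le
    exact ⟨.lam d, .head (ReadRule.r6 _ ol nl e).rm (rms_lam h)⟩

/-- Starting from `nil`, passing under abstractions only adds entries `#1`, and a suspended index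
over `nil` is evaluated by (r2). This base case breaks the circularity created by (r3). -/
theorem exists_reduct_susp_nil (d : DB C) (nl : ℕ) :
    ∃ d' : DB C, ReflTransGen RM (susp d.toSusp 0 nl nil) d'.toSusp := by
  refine exists_reduct_susp (P := fun d => ∃ i, d = .idx i) ⟨0, rfl⟩ ?_ d .nil trivial len_nil
    (by simp only [lev_nil, Nat.zero_le])
  rintro _ ⟨i, rfl⟩ nl
  exact ⟨.idx (i + nl), .single (ReadRule.r2 i nl).rm⟩

theorem exists_reduct_susp_simple (d : DB C) {e : Susp C .env} (hs : Simple (fun _ => True) e)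
    (he : e.WellFormed) {ol nl : ℕ} (hlen : len e = ol) (hlev : lev e ≤ nl) :
    ∃ d' : DB C, ReflTransGen RM (susp d.toSusp ol nl e) d'.toSusp :=
  exists_reduct_susp trivial (fun d _ nl => exists_reduct_susp_nil d nl) d hs he hlen hlev

/-- Lexicographic induction: (m4) and (m5) shorten `e₂`, while (m6) keeps `e₂` and shortens `e₁`. -/
theorem exists_reduct_merge {e₁ e₂ : Susp C .env} (hs₁ : Simple (fun _ => True) e₁)
    (hs₂ : Simple (fun _ => True) e₂) {nl₁ ol₂ : ℕ} (h : (merge e₁ nl₁ ol₂ e₂).WellFormed) :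
    ∃ e, Simple (fun _ => True) e ∧ ReflTransGen RM (merge e₁ nl₁ ol₂ e₂) e := by
  induction hs₂ generalizing nl₁ ol₂ e₁ with
  | nil =>
    obtain ⟨-, -, -, h⟩ := h
    obtain rfl : 0 = ol₂ := len_nil.symm.trans h
    exact ⟨e₁, hs₁, .single (MergeRule.m2 e₁ nl₁).rm⟩
  | @cons s hs l e₂ hs₂ ih =>
    induction hs₁ generalizing nl₁ with
    | nil =>
      rcases Nat.eq_zero_or_pos nl₁ with rfl | h0
      · exact ⟨_, .cons hs l hs₂, .single (MergeRule.m3 _ _).rm⟩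
      · have hr := MergeRule.m4 nl₁ ol₂ l s.toSusp e₂ h0
        obtain ⟨e, he, hr'⟩ := ih .nil (hr.denRel h).1
        exact ⟨e, he, .head hr.rm hr'⟩
    | @cons t ht n e₁ hs₁ ih₁ =>
      -- Well-formedness gives `n ≤ nl₁`, so (m5) and (m6) cover all cases.
      rcases Nat.lt_or_eq_of_le ((lev_cons _ _ _).ge.trans h.2.2.1) with hn | hn
      · have hr := MergeRule.m5 n nl₁ ol₂ l t.toSusp s.toSusp e₁ e₂ hn
        obtain ⟨e, he, hr'⟩ := ih (.cons ht n hs₁) (hr.denRel h).1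
        exact ⟨e, he, .head hr.rm hr'⟩
      · obtain rfl : n = nl₁ := hn
        have hr := MergeRule.m6 n ol₂ l t.toSusp s.toSusp e₁ e₂
        have hw := (hr.denRel h).1
        obtain ⟨d, hd⟩ := exists_reduct_susp_simple t (.cons hs l hs₂) h.2.1 h.2.2.2 (lev_cons _ _ _).le
        obtain ⟨e, he, hr'⟩ := ih₁ hw.2.1
        exact ⟨_, .cons trivial _ he, .head hr.rm (rms_cons _ hd hr')⟩

/-- Being fully evaluated: a de Bruijn term, or a list of de Bruijn terms with levels. -/
def Evaluated : {k : Kind} → Susp C k → Prop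
  | .tm, x => ∃ d : DB C, x = d.toSusp
  | .env, x => Simple (fun _ => True) x

theorem exists_evaluated {k : Kind} (x : Susp C k) (hx : x.WellFormed) :
    ∃ y, Evaluated y ∧ ReflTransGen RM x y := by
  induction x with
  | const c => exact ⟨_, ⟨.const c, rfl⟩, .refl⟩
  | idx i => exact ⟨_, ⟨.idx i, rfl⟩, .refl⟩
  | app t₁ t₂ h₁ h₂ =>
    obtain ⟨_, ⟨d₁, rfl⟩, h₁⟩ := h₁ hx.1
    obtain ⟨_, ⟨d₂, rfl⟩, h₂⟩ := h₂ hx.2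
    exact ⟨_, ⟨.app d₁ d₂, rfl⟩, rms_app h₁ h₂⟩
  | lam t h =>
    obtain ⟨_, ⟨d, rfl⟩, h⟩ := h hx
    exact ⟨_, ⟨.lam d, rfl⟩, rms_lam h⟩
  | susp t ol nl e ht he =>
    obtain ⟨_, ⟨d, rfl⟩, h₁⟩ := ht hx.1
    obtain ⟨e', hs, h₂⟩ := he hx.2.1
    have hl := len_lev_of_reflTransGen h₂ hx.2.1
    obtain ⟨d', h⟩ := exists_reduct_susp_simple d hs (wellFormed_of_reflTransGen h₂ hx.2.1)
      (hl.1.trans hx.2.2.1) (hl.2.trans hx.2.2.2)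
    exact ⟨_, ⟨d', rfl⟩, (rms_susp ol nl h₁ h₂).trans h⟩
  | nil => exact ⟨nil, Simple.nil, .refl⟩
  | cons t l e ht he =>
    obtain ⟨_, ⟨d, rfl⟩, h₁⟩ := ht hx.1
    obtain ⟨e', hs, h₂⟩ := he hx.2.1
    exact ⟨_, Simple.cons trivial l hs, rms_cons l h₁ h₂⟩
  | merge e₁ nl₁ ol₂ e₂ h₁ h₂ =>
    obtain ⟨e₁', hs₁, h₁⟩ := h₁ hx.1
    obtain ⟨e₂', hs₂, h₂⟩ := h₂ hx.2.1
    have hm := rms_merge nl₁ ol₂ h₁ h₂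
    obtain ⟨e, hs, h⟩ := exists_reduct_merge hs₁ hs₂ (wellFormed_of_reflTransGen hm hx)
    exact ⟨e, hs, hm.trans h⟩

/-! ### Uniqueness of normal forms -/

theorem WellFormed.reflTransGen_toSusp_den {t : Susp C .tm} (ht : t.WellFormed) :
    ReflTransGen RM t (den t).toSusp := by
  obtain ⟨_, ⟨d, rfl⟩, h⟩ := exists_evaluated t ht
  rwa [den_eq_of_reflTransGen h ht, den_toSusp]

/-- A normal form `w` is itself well-formed, hence reduces to `(den w).toSusp`; normality leaves
zero steps, and `den w = den t`. -/
theorem WellFormed.isRMNormalForm_iff {t : Susp C .tm} (ht : t.WellFormed) (w : Susp C .tm) :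
    IsRMNormalForm t w ↔ w = (den t).toSusp := by
  constructor
  · rintro ⟨h, hw⟩
    rw [den_eq_of_reflTransGen h ht]
    rcases (wellFormed_of_reflTransGen h ht).reflTransGen_toSusp_den.cases_head with h | ⟨z, hz, -⟩
    · exact h
    · exact absurd hz (hw z)
  · rintro rfl
    exact ⟨ht.reflTransGen_toSusp_den, fun _ => RM.elim_toSusp⟩

end Susp

theorem mainTheorem5 {C : Type*} (t s : Susp C Kind.tm) (ht : t.WellFormed)
    (h : Susp.BetaS t s) :
    ∃ t' s' : DB C,
      (∀ w : Susp C Kind.tm, Susp.IsRMNormalForm t w ↔ w = t'.toSusp) ∧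
      (∀ w : Susp C Kind.tm, Susp.IsRMNormalForm s w ↔ w = s'.toSusp) ∧
      Relation.ReflTransGen DB.Beta t' s' := by
  obtain ⟨hs, hd⟩ :=
    Susp.AtSub.denRel DB.compatible_reflTransGen_beta Susp.BetaSRule.denRel h ht
  exact ⟨t.den, s.den, ht.isRMNormalForm_iff, hs.isRMNormalForm_iff, hd⟩
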